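/- Let $\Gamma$ be a group. An LCL problem on $\Gamma$ is a triple $\Pi=(W,\Lambda,\mathcal A)$, where $W\subseteq\Gamma$ is finite, $\Lambda$ is a finite set and $\mathcal A\subseteq\Lambda^W$. A solution to $\Pi$ on an action of $\Gamma$ on a set $X$ is a function $f\colon X\to\Lambda$ such that for every $x\in X$ the map $W\to\Lambda$, $w\mapsto f(w\cdot x)$, belongs to $\mathcal A$. For a set $X$, the group $\Gamma$ acts on $X^\Gamma$ by $(\gamma\cdot x)(\delta)=x(\delta\gamma)$, and $\mathcal F(X,\Gamma)\subseteq X^\Gamma$ denotes the invariant set of all $x$ such that $\gamma\cdot x\ne x$ for every $\gamma\in\Gamma\setminus\{1\}$. Equip $[0,1]^\Gamma$ with the product of the Lebesgue measures and $\mathcal F([0,1],\Gamma)$ with its restriction. A function $f\colon\mathcal F([0,1],\Gamma)\to\Lambda$ to a finite set $\Lambda$ is called finitary if it is measurable (with respect to the completed measure) and for almost every $x\in\mathcal F([0,1],\Gamma)$ there is a finite set $D_x\subseteq\Gamma$ such that $f(x')=f(x)$ for every $x'\in\mathcal F([0,1],\Gamma)$ with $x'(\gamma)=x(\gamma)$ for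 all $\gamma\in D_x$. Let $\mathtt{FFIID}(\Gamma)$ be the class of all LCL problems on $\Gamma$ that have a finitary solution on $\mathcal F([0,1],\Gamma)$. Let $\mathtt{BaireSHIFT}(\Gamma)$ be the class of all LCL problems on $\Gamma$ that have a Baire-measurable solution on $\mathcal F(\{0,1\},\Gamma)$, where $\{0,1\}$ is discrete, $\mathcal F(\{0,1\},\Gamma)$ carries the subspace topology from the product $\{0,1\}^\Gamma$, and $f\colon\mathcal F(\{0,1\},\Gamma)\to\Lambda$ is Baire-measurable if the preimage of every subset of $\Lambda$ has the Baire property (differs from an open set by a meager set). Theorem. For every finitely generated group $\Gamma$, $\mathtt{FFIID}(\Gamma)\subseteq\mathtt{BaireSHIFT}(\Gamma)$. -/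

import Mathlib

open MeasureTheory

universe u v w

/-- A locally checkable labeling (LCL) problem on `Γ`: a finite window `W ⊆ Γ`, a finite set `Λ`
of labels and a family `𝒜 ⊆ Λ ^ W` of allowed configurations. -/
structure LCLProblem (Γ : Type u) where
  /-- the window `W` -/
  window : Finset Γ
  /-- the set `Λ` of labels -/
  Label : Type v
  /-- there are finitely many labels -/
  finite_label : Finite Label
  /-- the allowed configurations `𝒜 ⊆ Λ ^ W` -/
  allowed : Set (window → Label)

/-- `f : X → Λ` is a solution to the LCL problem `P` on the action of `Γ` on `X`: for every `x`,
the map `W → Λ, w ↦ f (w • x)` is an allowed configuration. -/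
def LCLProblem.IsSolution {Γ : Type u} [Group Γ] (P : LCLProblem.{u, v} Γ) {X : Type w}
    [MulAction Γ X] (f : X → P.Label) : Prop :=
  ∀ x : X, (fun w : P.window => f ((w : Γ) • x)) ∈ P.allowed

/-- The set `X ^ Γ` of all functions `Γ → X`. -/
def ShiftSpace (X : Type w) (Γ : Type u) : Type (max u w) := Γ → X

/-- The shift action `(γ • x) δ = x (δ * γ)`. -/
instance ShiftSpace.instMulAction (X : Type w) (Γ : Type u) [Group Γ] :
    MulAction Γ (ShiftSpace X Γ) where
  smul γ x := fun δ => x (δ * γ)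
  one_smul x := funext fun δ => congrArg x (mul_one δ)
  mul_smul γ γ' x := funext fun δ => congrArg x (mul_assoc δ γ γ').symm

/-- The product topology. -/
instance ShiftSpace.instTopologicalSpace (X : Type w) (Γ : Type u) [TopologicalSpace X] :
    TopologicalSpace (ShiftSpace X Γ) :=
  inferInstanceAs (TopologicalSpace (Γ → X))

/-- The product `σ`-algebra. -/
instance ShiftSpace.instMeasurableSpace (X : Type w) (Γ : Type u) [MeasurableSpace X] :
    MeasurableSpace (ShiftSpace X Γ) :=
  inferInstanceAs (MeasurableSpace (Γ → X))

/-- The free part of the shift action: all `x` with `γ • x ≠ x` for every `γ ≠ 1`. It is invariant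
under `Γ`, and as a type it carries the restricted action, the subspace topology and the trace
`σ`-algebra. -/
def freePart (X : Type w) (Γ : Type u) [Group Γ] : SubMulAction Γ (ShiftSpace X Γ) where
  carrier := {x | ∀ γ : Γ, γ ≠ 1 → γ • x ≠ x}
  smul_mem' := by
    intro g x hx γ hγ h
    refine hx (g⁻¹ * γ * g) (fun h1 => hγ ?_) ?_
    · have h2 : γ = g * (g⁻¹ * γ * g) * g⁻¹ := by group
      rw [h2, h1, mul_one, mul_inv_cancel]
    · rw [mul_smul, mul_smul, h, inv_smul_smul]

/-- The product of the Lebesgue measures on the factors of `[0, 1] ^ Γ`. -/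
noncomputable def ShiftSpace.productMeasure (Γ : Type u) :
    Measure (ShiftSpace unitInterval Γ) :=
  Measure.infinitePi (fun _ : Γ => (volume : Measure unitInterval))

/-- The product of Lebesgue measures on `[0, 1] ^ Γ`, restricted to the free part. -/
noncomputable def iidMeasure (Γ : Type u) [Group Γ] : Measure (freePart unitInterval Γ) :=
  Measure.comap Subtype.val (ShiftSpace.productMeasure Γ)

/-- `f`, with values in a discrete space, is measurable with respect to the completion of `μ`. -/
def IsMuMeasurable {X : Type w} [MeasurableSpace X] (μ : Measure X) {Λ : Type v}
    (f : X → Λ) : Prop :=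
  ∀ s : Set Λ, NullMeasurableSet (f ⁻¹' s) μ

/-- `f`, with values in a discrete space, is Baire-measurable: preimages of sets differ from
Borel (equivalently, open) sets by meager sets. -/
def IsBaireMeasurable {X : Type w} [TopologicalSpace X] {Λ : Type v} (f : X → Λ) : Prop :=
  ∀ s : Set Λ, BaireMeasurableSet (f ⁻¹' s)

/-- A measurable function `f` on the free part of `[0, 1] ^ Γ` is finitary if for almost every `x`
there is a finite set `D ⊆ Γ` such that `f x = f x'` whenever `x'` in the free part agrees with
`x` on `D`. -/
def IsFinitary {Γ : Type u} [Group Γ] {Λ : Type v} (f : freePart unitInterval Γ → Λ) : Prop :=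
  IsMuMeasurable (iidMeasure Γ) f ∧
    ∀ᵐ x ∂(iidMeasure Γ), ∃ D : Finset Γ,
      ∀ x' : freePart unitInterval Γ, (∀ γ ∈ D, x.val γ = x'.val γ) → f x = f x'

/-- The LCL problems with a finitary solution on the free part of `[0, 1] ^ Γ`. -/
def FFIID (Γ : Type u) [Group Γ] : Set (LCLProblem.{u, v} Γ) :=
  {P | ∃ f : freePart unitInterval Γ → P.Label, P.IsSolution f ∧ IsFinitary f}

/-- The LCL problems with a Baire-measurable solution on the free part of `2 ^ Γ`, where
`2 = {0, 1}` is discrete. -/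
def BaireSHIFT (Γ : Type u) [Group Γ] : Set (LCLProblem.{u, v} Γ) :=
  {P | ∃ f : freePart (Fin 2) Γ → P.Label, P.IsSolution f ∧ IsBaireMeasurable f}

/-! For infinite `Γ`, the finitary solution `f` is transferred to `2 ^ Γ` by local rules, the tiles.
A tile gives a label to the points of a clopen set and promises a condition of positive outer
measure on finitely many coordinates of `[0, 1] ^ Γ` that forces `f` to take this label. If the
conditions occurring around `x` are laminar, independence makes finitely many of them satisfiable at
once (`infinitePi_biInter_ne_zero`). So the labels on a window around `x` are those of `f` around
some free point `t`, and hence are allowed.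

Compatible tiles can be made dense (`exists_tile`): an open set contains a free point `x` of finite
support, in which finitely many earlier tiles occur only finitely often. As `f` is finitary, their
joint condition can be refined to one that fixes the value of `f`, and this gives a new tile on a
neighbourhood of `x`. By Baire category, every point of a generic orbit meets a tile and takes the
label of the first one. The remaining orbits use a solution obtained by choice. -/

namespace ShiftSpace

theorem smul_apply {X : Type w} {Γ : Type u} [Group Γ] (γ : Γ) (x : ShiftSpace X Γ) (δ : Γ) :
    (γ • x) δ = x (δ * γ) := rfl

theorem ne_iff {X : Type w} {Γ : Type u} {x y : ShiftSpace X Γ} :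
    x ≠ y ↔ ∃ δ, x δ ≠ y δ := Function.ne_iff

theorem measurable_eval {X : Type w} [MeasurableSpace X] {Γ : Type u} (δ : Γ) :
    Measurable fun t : ShiftSpace X Γ => t δ :=
  measurable_pi_apply (X := fun _ : Γ => X) δ

theorem continuous_eval {X : Type w} [TopologicalSpace X] {Γ : Type u} (δ : Γ) :
    Continuous fun x : ShiftSpace X Γ => x δ :=
  continuous_apply (A := fun _ : Γ => X) δ

theorem continuous_smul {X : Type w} [TopologicalSpace X] {Γ : Type u} [Group Γ] (γ : Γ) :
    Continuous fun x : ShiftSpace X Γ => γ • x :=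
  continuous_pi (A := fun _ : Γ => X) fun δ => continuous_eval (δ * γ)

instance (Γ : Type u) : IsProbabilityMeasure (productMeasure Γ) :=
  inferInstanceAs (IsProbabilityMeasure (Measure.infinitePi fun _ : Γ => (volume : Measure unitInterval)))

end ShiftSpace

open ShiftSpace

/-! ### Independence of disjoint sets of coordinates -/

/-- An infinite product measure splits as the product of its restrictions to a set of coordinates
and to the complement. -/
theorem infinitePi_prod_map_symm {ι : Type u} {X : Type w} [MeasurableSpace X] (ν : Measure X)
    [IsProbabilityMeasure ν] (p : ι → Prop) [DecidablePred p] :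
    ((Measure.infinitePi fun _ : {i // p i} => ν).prod
      (Measure.infinitePi fun _ : {i // ¬ p i} => ν)).map
        (MeasurableEquiv.piEquivPiSubtypeProd (fun _ : ι => X) p).symm =
      Measure.infinitePi fun _ : ι => ν := by
  refine Measure.eq_infinitePi _ fun s t ht => ?_
  rw [MeasurableEquiv.map_apply]
  have : (MeasurableEquiv.piEquivPiSubtypeProd (fun _ : ι => X) p).symm ⁻¹' (Set.pi s t) =
      (Set.pi (s.subtype p : Set {i // p i}) fun i => t i) ×ˢ
        (Set.pi (s.subtype fun i => ¬ p i : Set {i // ¬ p i}) fun i => t i) := by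
    ext ⟨a, b⟩
    simp only [Set.mem_preimage, Set.mem_pi, Set.mem_prod, Finset.mem_coe, Finset.mem_subtype]
    constructor
    · intro h
      refine ⟨fun i hi => ?_, fun i hi => ?_⟩
      · have := h i hi
        simpa [MeasurableEquiv.piEquivPiSubtypeProd, Equiv.piEquivPiSubtypeProd, i.2] using this
      · have := h i hi
        simpa [MeasurableEquiv.piEquivPiSubtypeProd, Equiv.piEquivPiSubtypeProd, i.2] using this
    · rintro ⟨h1, h2⟩ i hi
      by_cases hp : p i
      · simpa [MeasurableEquiv.piEquivPiSubtypeProd, Equiv.piEquivPiSubtypeProd, hp]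
          using h1 ⟨i, hp⟩ hi
      · simpa [MeasurableEquiv.piEquivPiSubtypeProd, Equiv.piEquivPiSubtypeProd, hp]
          using h2 ⟨i, hp⟩ hi
  rw [this, Measure.prod_prod,
    Measure.infinitePi_pi (t := fun i : {i // p i} => t i) _ fun i _ => ht i,
    Measure.infinitePi_pi (t := fun i : {i // ¬ p i} => t i) _ fun i _ => ht i,
    Finset.prod_subtype_eq_prod_filter (f := fun i => ν (t i)),
    Finset.prod_subtype_eq_prod_filter (f := fun i => ν (t i)),
    Finset.prod_filter_mul_prod_filter_not]

/-- Membership in `A` depends only on the coordinates in `S`. -/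
def IsSupportedOn {ι : Type u} {X : Type w} (A : Set (ι → X)) (S : Set ι) : Prop :=
  ∀ ⦃x y : ι → X⦄, (∀ i ∈ S, x i = y i) → x ∈ A → y ∈ A

/-- Sets of positive outer measure that are supported on disjoint sets of coordinates have an
intersection of positive outer measure. No measurability is required. -/
theorem infinitePi_inter_ne_zero {ι : Type u} {X : Type w} [MeasurableSpace X] (ν : Measure X)
    [IsProbabilityMeasure ν] {A B : Set (ι → X)} {S T : Set ι} (hA : IsSupportedOn A S)
    (hB : IsSupportedOn B T) (hST : Disjoint S T)
    (hA0 : Measure.infinitePi (fun _ : ι => ν) A ≠ 0)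
    (hB0 : Measure.infinitePi (fun _ : ι => ν) B ≠ 0) :
    Measure.infinitePi (fun _ : ι => ν) (A ∩ B) ≠ 0 := by
  classical
  set e := MeasurableEquiv.piEquivPiSubtypeProd (fun _ : ι => X) (· ∈ S)
  have e1 : ∀ a b (i : ι) (hi : i ∈ S), e.symm (a, b) i = a ⟨i, hi⟩ := fun a b i hi => by
    simp [e, MeasurableEquiv.piEquivPiSubtypeProd, Equiv.piEquivPiSubtypeProd, hi]
  have e2 : ∀ a b (i : ι) (hi : i ∉ S), e.symm (a, b) i = b ⟨i, hi⟩ := fun a b i hi => by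
    simp [e, MeasurableEquiv.piEquivPiSubtypeProd, Equiv.piEquivPiSubtypeProd, hi]
  -- `x0` only fills the coordinates on which `A` or `B` does not depend.
  obtain ⟨x0, -⟩ : A.Nonempty := nonempty_of_measure_ne_zero hA0
  set A' : Set ({i // i ∈ S} → X) := {a | e.symm (a, fun i => x0 i) ∈ A}
  set B' : Set ({i // i ∉ S} → X) := {b | e.symm (fun i => x0 i, b) ∈ B}
  have hAe : e.symm ⁻¹' A = A' ×ˢ Set.univ := by
    ext ⟨a, b⟩
    simp only [Set.mem_preimage, Set.mem_prod, Set.mem_univ, and_true, A', Set.mem_ofPred_eq]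
    constructor <;> exact hA fun i hi => by rw [e1 _ _ i hi, e1 _ _ i hi]
  have hBe : e.symm ⁻¹' B = Set.univ ×ˢ B' := by
    ext ⟨a, b⟩
    simp only [Set.mem_preimage, Set.mem_prod, Set.mem_univ, true_and, B', Set.mem_ofPred_eq]
    constructor <;> exact hB fun i hi => by
      have := hST.notMem_of_mem_right hi
      rw [e2 _ _ i this, e2 _ _ i this]
  rw [← infinitePi_prod_map_symm ν (· ∈ S), MeasurableEquiv.map_apply] at hA0 hB0 ⊢
  rw [Set.preimage_inter, hAe, hBe, Set.prod_inter_prod, Set.inter_univ, Set.univ_inter,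
    Measure.prod_prod]
  rw [hAe, Measure.prod_prod] at hA0
  rw [hBe, Measure.prod_prod] at hB0
  exact mul_ne_zero (left_ne_zero_of_mul hA0) (right_ne_zero_of_mul hB0)

/-! ### Invariance of the product measure and almost sure freeness -/

section Group

variable {Γ : Type u} [Group Γ]

theorem ShiftSpace.productMeasure_preimage_smul (γ : Γ) (A : Set (ShiftSpace unitInterval Γ)) :
    productMeasure Γ {t | γ • t ∈ A} = productMeasure Γ A := by
  have hm : ∀ γ : Γ, Measurable fun t : ShiftSpace unitInterval Γ => γ • t := fun γ =>
    measurable_pi_lambda _ fun δ => measurable_pi_apply (δ * γ)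
  let e : ShiftSpace unitInterval Γ ≃ᵐ ShiftSpace unitInterval Γ :=
    { toEquiv := MulAction.toPerm γ
      measurable_toFun := hm γ
      measurable_invFun := hm γ⁻¹ }
  have he : MeasurePreserving e (productMeasure Γ) (productMeasure Γ) := by
    refine ⟨hm γ, ?_⟩
    exact Measure.map_infinitePi_infinitePi_of_inj
      (P := fun _ : Γ => (volume : Measure unitInterval)) (mul_left_injective γ)
  exact he.measure_preimage_equiv A

theorem measurableSet_freePart [Countable Γ] :
    MeasurableSet {t : ShiftSpace unitInterval Γ | t ∈ freePart unitInterval Γ} := by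
  have : {t : ShiftSpace unitInterval Γ | t ∈ freePart unitInterval Γ} =
      ⋂ γ : Γ, ⋂ _ : γ ≠ 1, ⋃ δ : Γ, {t | t (δ * γ) = t δ}ᶜ := by
    ext t
    simp only [Set.mem_iInter, Set.mem_iUnion, Set.mem_compl_iff, Set.mem_ofPred_eq]
    refine forall₂_congr fun γ _ => ?_
    exact ShiftSpace.ne_iff
  rw [this]
  refine .iInter fun γ => .iInter fun _ => .iUnion fun δ => MeasurableSet.compl ?_
  exact measurableSet_eq_fun (measurable_eval (δ * γ)) (measurable_eval δ)

/-- A point fixed by `γ ≠ 1` has equal coordinates at `γ` and `1`, and the diagonal of the square is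
null. -/
theorem ae_mem_freePart [Countable Γ] :
    ∀ᵐ t ∂productMeasure Γ, t ∈ freePart unitInterval Γ := by
  have h : ∀ γ : Γ, γ ≠ 1 → ∀ᵐ t ∂productMeasure Γ, γ • t ≠ t := by
    intro γ hγ
    have h0 : ((volume : Measure unitInterval).prod volume) (Set.diagonal unitInterval) = 0 := by
      rw [Measure.measure_prod_null measurableSet_diagonal]
      refine .of_forall fun a => ?_
      have : Prod.mk a ⁻¹' Set.diagonal unitInterval = {a} := by ext b; simp [eq_comm]
      simp only [this, Pi.zero_apply]
      exact measure_singleton a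
    rw [← Measure.infinitePi_map_eval_prod (P := fun _ : Γ => (volume : Measure unitInterval)) hγ,
      Measure.map_apply (by fun_prop) measurableSet_diagonal] at h0
    refine measure_mono_null (fun t ht => ?_) h0
    have ht' : γ • t = t := not_not.mp ht
    have := congrFun ht' 1
    rw [ShiftSpace.smul_apply, one_mul] at this
    exact this
  filter_upwards [ae_all_iff.2 fun γ : Γ => ae_all_iff.2 (h γ)] with t ht
  exact ht

/-- Almost every statement about the free part is an almost every statement about all points. -/
theorem ae_of_ae_iidMeasure [Countable Γ] {p : freePart unitInterval Γ → Prop}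
    (h : ∀ᵐ x ∂iidMeasure Γ, p x) :
    ∀ᵐ t ∂productMeasure Γ, ∃ ht : t ∈ freePart unitInterval Γ, p ⟨t, ht⟩ := by
  have h0 : iidMeasure Γ {x | ¬ p x} = 0 := h
  rw [iidMeasure, (MeasurableEmbedding.subtype_coe measurableSet_freePart).comap_apply] at h0
  have h1 : ∀ᵐ t ∂productMeasure Γ, t ∉ Subtype.val '' {x : freePart unitInterval Γ | ¬ p x} :=
    measure_eq_zero_iff_ae_notMem.1 h0
  filter_upwards [h1, ae_mem_freePart] with t ht1 ht2
  exact ⟨ht2, by_contra fun hp => ht1 ⟨⟨t, ht2⟩, hp, rfl⟩⟩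

end Group

/-! ### Free points of finite support -/

open scoped Pointwise in
/-- Every nonempty open subset of `2 ^ Γ`, for an infinite group `Γ`, contains a point of the free
part that has finite nonempty support. -/
theorem exists_mem_freePart_finite_support {Γ : Type u} [Group Γ] [Infinite Γ]
    {U : Set (ShiftSpace (Fin 2) Γ)} (hU : IsOpen U) (hne : U.Nonempty) :
    ∃ x ∈ U, x ∈ freePart (Fin 2) Γ ∧ {δ | x δ ≠ 0}.Finite ∧ ∃ δ, x δ ≠ 0 := by
  classical
  obtain ⟨y, hy⟩ := hne
  obtain ⟨I, u, hu, hIU⟩ := isOpen_pi_iff.1 hU y hy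
  obtain ⟨a, ha⟩ := Infinite.exists_notMem_finset I
  obtain ⟨b, hb⟩ := Infinite.exists_notMem_finset (insert a I)
  -- The point will be the indicator of `Z ∪ {g}`. If `γ ≠ 1` fixes it, then `g * γ ∈ Z`, and `c * γ
  -- ∈ Z` for some `c ∈ {a, b}`, as `a` and `b` cannot both be sent to `g`. This puts `g` in `Z *
  -- Z⁻¹ * Z`.
  set Z : Finset Γ := insert a (insert b (I.filter fun i => y i ≠ 0))
  obtain ⟨g, hg⟩ := Infinite.exists_notMem_finset (I ∪ Z * Z⁻¹ * Z)
  rw [Finset.notMem_union] at hg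
  rw [Finset.mem_insert, not_or] at hb
  let x : ShiftSpace (Fin 2) Γ := fun δ => if δ ∈ insert g Z then 1 else 0
  have hx : ∀ δ, x δ ≠ 0 ↔ δ ∈ insert g Z := fun δ => by
    by_cases h : δ ∈ insert g Z <;> simp only [x, h] <;> simp
  have haZ : a ∈ Z := by simp [Z]
  have hbZ : b ∈ Z := by simp [Z]
  refine ⟨x, hIU fun i hi => ?_, fun γ hγ h => ?_,
    (insert g Z).finite_toSet.subset fun δ hδ => (hx δ).1 hδ, g, (hx g).2 (by simp)⟩
  · have hxy : x i = y i := by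
      have h1 : i ∈ insert g Z ↔ y i ≠ 0 := by
        have hig : i ≠ g := fun h => hg.1 (h ▸ hi)
        have hia : i ≠ a := fun h => ha (h ▸ hi)
        have hib : i ≠ b := fun h => hb.2 (h ▸ hi)
        simp [Z, hig, hia, hib, Finset.mem_coe.1 hi]
      rw [← hx] at h1
      omega
    rw [hxy]
    exact (hu i hi).2
  · have hmem : ∀ δ ∈ insert g Z, δ * γ ∈ insert g Z := fun δ hδ =>
      (hx (δ * γ)).1 (ne_of_eq_of_ne (congrFun h δ) ((hx δ).2 hδ))
    have hgz : g * γ ∈ Z :=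
      (Finset.mem_insert.1 (hmem g (by simp))).resolve_left fun h => hγ (mul_eq_left.1 h)
    obtain ⟨c, hc, hcg⟩ : ∃ c ∈ Z, c * γ ≠ g := by
      by_contra! H
      exact hb.1 (mul_right_cancel ((H b hbZ).trans (H a haZ).symm))
    have hcz : c * γ ∈ Z :=
      (Finset.mem_insert.1 (hmem c (Finset.mem_insert_of_mem hc))).resolve_left hcg
    refine hg.2 ?_
    have : g = (g * γ) * (c * γ)⁻¹ * c := by group
    rw [this]
    exact Finset.mul_mem_mul (Finset.mul_mem_mul hgz (Finset.inv_mem_inv hcz)) hc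

/-! ### Laminar families -/

/-- Two pairs (set of coordinates, set supported on it) are laminar if the sets of coordinates are
disjoint, or one contains the other and the corresponding sets are contained the other way. -/
def Laminar {α : Type u} {β : Type v} (p q : Set α × Set β) : Prop :=
  Disjoint p.1 q.1 ∨ (p.1 ⊆ q.1 ∧ q.2 ⊆ p.2) ∨ (q.1 ⊆ p.1 ∧ p.2 ⊆ q.2)

namespace Laminar

variable {α : Type u} {β : Type v} {p q : Set α × Set β}

theorem refl (p : Set α × Set β) : Laminar p p := .inr (.inl ⟨subset_rfl, subset_rfl⟩)

theorem symm (h : Laminar p q) : Laminar q p :=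
  h.imp (fun h => h.symm) Or.symm

theorem preimage (h : Laminar p q) (a : α → α) (b : β → β) :
    Laminar (a ⁻¹' p.1, b ⁻¹' p.2) (a ⁻¹' q.1, b ⁻¹' q.2) :=
  h.imp (fun h => h.preimage a) <| Or.imp
    (fun h => ⟨Set.preimage_mono h.1, Set.preimage_mono h.2⟩)
    (fun h => ⟨Set.preimage_mono h.1, Set.preimage_mono h.2⟩)

end Laminar

theorem IsSupportedOn.biInter {ι : Type u} {X : Type w} {T : Set (Set ι × Set (ι → X))}
    (h : ∀ p ∈ T, IsSupportedOn p.2 p.1) :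
    IsSupportedOn (⋂ p ∈ T, p.2) (⋃ p ∈ T, p.1) := by
  intro x y hxy hx
  rw [Set.mem_iInter₂] at hx ⊢
  exact fun p hp => h p hp (fun i hi => hxy i (Set.mem_biUnion hp hi)) (hx p hp)

/-- The intersection of a finite laminar family of sets of positive outer measure has positive
outer measure. -/
theorem infinitePi_biInter_ne_zero {ι : Type u} {X : Type w} [MeasurableSpace X] (ν : Measure X)
    [IsProbabilityMeasure ν] (T : Finset (Set ι × Set (ι → X)))
    (hs : ∀ p ∈ T, IsSupportedOn p.2 p.1)
    (h0 : ∀ p ∈ T, Measure.infinitePi (fun _ : ι => ν) p.2 ≠ 0)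
    (hl : ∀ p ∈ T, ∀ q ∈ T, Laminar p q) :
    Measure.infinitePi (fun _ : ι => ν) (⋂ p ∈ T, p.2) ≠ 0 := by
  classical
  induction T using Finset.strongInduction with
  | H T ih =>
  obtain rfl | ⟨p, hp⟩ := T.eq_empty_or_nonempty
  · simp
  have ih' : ∀ S ⊂ T, Measure.infinitePi (fun _ : ι => ν) (⋂ p ∈ S, p.2) ≠ 0 := fun S hS =>
    ih S hS (fun q hq => hs q (hS.1 hq)) (fun q hq => h0 q (hS.1 hq))
      fun q hq r hr => hl q (hS.1 hq) r (hS.1 hr)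
  -- If another condition implies that of `p`, then `p` can be dropped. Otherwise every other member
  -- either is implied by `p` or lives on coordinates disjoint from `p`, where independence applies.
  by_cases hq : ∃ q ∈ T.erase p, q.2 ⊆ p.2
  · obtain ⟨q, hq, hqp⟩ := hq
    convert ih' _ (Finset.erase_ssubset hp) using 2
    ext t
    simp only [Set.mem_iInter]
    refine ⟨fun h r hr => h r (Finset.mem_of_mem_erase hr), fun h r hr => ?_⟩
    by_cases hrp : r = p
    · exact hrp ▸ hqp (h q hq)
    · exact h r (Finset.mem_erase.2 ⟨hrp, hr⟩)
  · push Not at hq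
    set S := (T.erase p).filter fun q => Disjoint p.1 q.1
    have hST : S ⊂ T := (Finset.filter_subset _ _).trans_ssubset (Finset.erase_ssubset hp)
    have hdisj : Disjoint p.1 (⋃ q ∈ (S : Set (Set ι × Set (ι → X))), q.1) := by
      simp only [Set.disjoint_iUnion_right]
      exact fun q hq => (Finset.mem_filter.1 hq).2
    have := infinitePi_inter_ne_zero ν (hs p hp)
      (IsSupportedOn.biInter fun q hq => hs q (hST.1 hq)) hdisj (h0 p hp) (ih' S hST)
    convert this using 2
    ext t
    simp only [Set.mem_iInter, Set.mem_inter_iff, Finset.mem_coe]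
    refine ⟨fun h => ⟨h p hp, fun r hr => h r (hST.1 hr)⟩, fun h r hr => ?_⟩
    by_cases hrp : r = p
    · exact hrp ▸ h.1
    have hre : r ∈ T.erase p := Finset.mem_erase.2 ⟨hrp, hr⟩
    rcases hl p hp r hr with hd | hd | hd
    · exact h.2 r (Finset.mem_filter.2 ⟨hre, hd⟩)
    · exact absurd hd.2 (hq r hre)
    · exact hd.2 h.1

/-! ### Solutions by choice and greedy sequences -/

/-- An action of `Γ` on a nonempty set with a solution to an LCL problem yields a solution on every
free part, by a choice of orbit representatives. -/
theorem LCLProblem.IsSolution.exists_freePart {Γ : Type u} [Group Γ] {P : LCLProblem.{u, v} Γ}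
    {Y : Type w} [MulAction Γ Y] {f : Y → P.Label} (hf : P.IsSolution f) (t : Y) (X : Type*) :
    ∃ s : freePart X Γ → P.Label, P.IsSolution s := by
  let rep : freePart X Γ → freePart X Γ := fun x =>
    Quotient.out (Quotient.mk (MulAction.orbitRel Γ (freePart X Γ)) x)
  have hrep : ∀ x, ∃ γ : Γ, γ • rep x = x := fun x =>
    (MulAction.orbitRel Γ (freePart X Γ)).symm (Quotient.mk_out x)
  choose c hc using hrep
  have hrs : ∀ (γ : Γ) x, rep (γ • x) = rep x := fun γ x =>
    congrArg Quotient.out (Quotient.sound ⟨γ, rfl⟩)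
  -- Freeness makes the element carrying `rep x` to `x` unique, so `x ↦ c x • t` is equivariant.
  have hcs : ∀ (γ : Γ) x, c (γ • x) = γ * c x := by
    intro γ x
    by_contra h
    refine (rep x).2 ((γ * c x)⁻¹ * c (γ • x)) (fun h' => h (inv_mul_eq_one.1 h').symm) ?_
    have h1 := hc (γ • x)
    rw [hrs] at h1
    rw [← SubMulAction.val_smul, mul_smul, h1]
    exact congrArg Subtype.val (inv_smul_eq_iff.2 (by rw [mul_smul, hc]))
  refine ⟨fun x => f (c x • t), fun x => ?_⟩
  simp only [hcs, mul_smul]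
  exact hf (c x • t)

/-- A sequence of objects that are pairwise related, with the `n`-th one satisfying `p n`. -/
theorem exists_seq_pairwise {α : Type*} (r : α → α → Prop) (hr : ∀ a b, r a b → r b a)
    (p : ℕ → α → Prop)
    (h : ∀ n (L : Finset α), (∀ a ∈ L, ∀ b ∈ L, r a b) → ∃ c, (∀ a ∈ L, r a c) ∧ r c c ∧ p n c) :
    ∃ g : ℕ → α, (∀ m n, r (g m) (g n)) ∧ ∀ n, p n (g n) := by
  classical
  choose c hc using fun n (L : {L : Finset α // ∀ a ∈ L, ∀ b ∈ L, r a b}) => h n L.1 L.2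
  have hins : ∀ n L, ∀ a ∈ insert (c n L) L.1, ∀ b ∈ insert (c n L) L.1, r a b := by
    intro n L a ha b hb
    rcases Finset.mem_insert.1 ha with rfl | ha <;> rcases Finset.mem_insert.1 hb with rfl | hb
    · exact (hc n L).2.1
    · exact hr _ _ ((hc n L).1 b hb)
    · exact (hc n L).1 a ha
    · exact L.2 a ha b hb
  let S : ℕ → {L : Finset α // ∀ a ∈ L, ∀ b ∈ L, r a b} := fun n =>
    Nat.rec ⟨∅, by simp⟩ (fun n L => ⟨insert (c n L) L.1, hins n L⟩) n
  have hS : ∀ n, (S (n + 1)).1 = insert (c n (S n)) (S n).1 := fun n => rfl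
  have hmono : Monotone fun n => (S n).1 := monotone_nat_of_le_succ fun n => by
    simp only [hS]; exact Finset.subset_insert _ _
  have hmem : ∀ m n, m ≤ n → c m (S m) ∈ (S (n + 1)).1 := fun m n hmn =>
    hmono (Nat.succ_le_succ hmn) (by simp only [hS]; exact Finset.mem_insert_self _ _)
  refine ⟨fun n => c n (S n), fun m n => ?_, fun n => (hc n (S n)).2.2⟩
  exact (S (max m n + 1)).2 _ (hmem m _ (le_max_left m n)) _ (hmem n _ (le_max_right m n))

/-! ### Tiles and their extension -/

section Tile

variable {Γ : Type u} [Group Γ] {Λ : Type v}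

/-- A local rule: whenever `x ∈ 2 ^ Γ` lies in the clopen set `loc`, the point `x` receives the
label `value`. This promises that the points of `[0, 1] ^ Γ` used to solve the problem near `x` lie
in `cond`, a set of positive outer measure that is supported on `supp` and on which `f` is constant
with the same value. -/
structure Tile (f : freePart unitInterval Γ → Λ) where
  /-- the coordinates that are constrained -/
  supp : Finset Γ
  /-- the constraint -/
  cond : Set (ShiftSpace unitInterval Γ)
  /-- the place where the rule applies -/
  loc : Set (ShiftSpace (Fin 2) Γ)
  /-- the label -/
  value : Λ
  isSupportedOn : IsSupportedOn (ι := Γ) cond (supp : Set Γ)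
  cond_ne_zero : productMeasure Γ cond ≠ 0
  eq_value : ∀ t : freePart unitInterval Γ, t.val ∈ cond → f t = value
  isClopen_loc : IsClopen loc
  -- This keeps the tile from occurring infinitely often in a point of finite support.
  exists_ne_zero : ∃ F : Finset Γ, ∀ x ∈ loc, ∃ δ ∈ F, x δ ≠ 0

namespace Tile

variable {f : freePart unitInterval Γ → Λ}

/-- The coordinates and the constraint of the translate by `γ` of a tile. -/
def place (P : Tile f) (γ : Γ) : Set Γ × Set (ShiftSpace unitInterval Γ) :=
  ((fun δ => δ * γ⁻¹) ⁻¹' P.supp, (fun t => γ • t) ⁻¹' P.cond)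

theorem isSupportedOn_place (P : Tile f) (γ : Γ) :
    IsSupportedOn (ι := Γ) (P.place γ).2 (P.place γ).1 := by
  intro t t' h ht
  refine P.isSupportedOn (fun δ hδ => ?_) ht
  exact h (δ * γ) (by simpa [place] using hδ)

theorem place_ne_zero (P : Tile f) (γ : Γ) : productMeasure Γ (P.place γ).2 ≠ 0 :=
  (productMeasure_preimage_smul γ P.cond).trans_ne P.cond_ne_zero

theorem finite_place (P : Tile f) (γ : Γ) : (P.place γ).1.Finite :=
  P.supp.finite_toSet.preimage (mul_left_injective γ⁻¹).injOn

theorem place_mul (P : Tile f) (γ η : Γ) :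
    P.place (γ * η) = ((fun δ => δ * η⁻¹) ⁻¹' (P.place γ).1, (fun t => η • t) ⁻¹' (P.place γ).2) := by
  ext x <;> simp [place, mul_assoc, mul_smul]

/-- Translates of two tiles that occur in the same point are laminar. -/
def Compatible (P Q : Tile f) : Prop :=
  ∀ (x : ShiftSpace (Fin 2) Γ) (γ η : Γ), γ • x ∈ P.loc → η • x ∈ Q.loc →
    Laminar (P.place γ) (Q.place η)

theorem Compatible.symm {P Q : Tile f} (h : P.Compatible Q) : Q.Compatible P :=
  fun x γ η hγ hη => (h x η γ hη hγ).symm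

/-- Laminarity is preserved by translation, so replacing `x` by `η • x` reduces to `η = 1`. -/
theorem compatible_of_forall_one {P Q : Tile f}
    (h : ∀ x ∈ Q.loc, ∀ γ : Γ, γ • x ∈ P.loc → Laminar (P.place γ) (Q.place 1)) :
    P.Compatible Q := by
  intro x γ η hγ hη
  have := (h (η • x) hη (γ * η⁻¹) (by rwa [smul_smul, inv_mul_cancel_right])).preimage
    (fun δ => δ * η⁻¹) (fun t => η • t)
  rwa [← place_mul, ← place_mul, inv_mul_cancel_right, one_mul] at this

/-- If `x` has finite support, then a tile occurs in `x` only finitely often. -/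
theorem finite_occurrences (P : Tile f) {x : ShiftSpace (Fin 2) Γ} (hx : {δ | x δ ≠ 0}.Finite) :
    {γ : Γ | γ • x ∈ P.loc}.Finite := by
  obtain ⟨F, hF⟩ := P.exists_ne_zero
  refine (Set.Finite.biUnion F.finite_toSet fun ε _ =>
    hx.preimage (f := fun γ => ε * γ) (mul_right_injective ε).injOn).subset fun γ hγ => ?_
  obtain ⟨ε, hε, h⟩ := hF _ hγ
  exact Set.mem_biUnion hε h

end Tile

/-- A set of positive outer measure that is supported on finitely many coordinates can be shrunk
to another such set on which the finitary function `f` is constant. -/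
theorem exists_subset_const [Countable Γ] [Countable Λ] {f : freePart unitInterval Γ → Λ}
    (hf : ∀ᵐ t ∂productMeasure Γ, ∃ ht : t ∈ freePart unitInterval Γ, ∃ D : Finset Γ,
      ∀ x' : freePart unitInterval Γ, (∀ γ ∈ D, t γ = x'.val γ) → f ⟨t, ht⟩ = f x')
    {C : Set (ShiftSpace unitInterval Γ)} {S : Set Γ} (hS : S.Finite)
    (hC : IsSupportedOn (ι := Γ) C S) (hC0 : productMeasure Γ C ≠ 0) :
    ∃ (D : Finset Γ) (B : Set (ShiftSpace unitInterval Γ)) (l : Λ), S ⊆ D ∧ B ⊆ C ∧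
      IsSupportedOn (ι := Γ) B (D : Set Γ) ∧ productMeasure Γ B ≠ 0 ∧
      ∀ t : freePart unitInterval Γ, t.val ∈ B → f t = l := by
  classical
  -- `A d` collects the points where the coordinates in `d.1` certify the label `d.2`. These
  -- countably many sets cover almost every point, so one of them meets `C` in positive outer
  -- measure.
  let A : Finset Γ × Λ → Set (ShiftSpace unitInterval Γ) := fun d =>
    {t | ∀ x' : freePart unitInterval Γ, (∀ γ ∈ d.1, t γ = x'.val γ) → f x' = d.2}
  obtain ⟨d, hd⟩ : ∃ d, productMeasure Γ (C ∩ A d) ≠ 0 := by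
    by_contra! H
    refine hC0 ?_
    rw [measure_eq_zero_iff_ae_notMem]
    filter_upwards [hf, measure_eq_zero_iff_ae_notMem.1 (measure_iUnion_null H)] with t ht h1 htC
    obtain ⟨ht, D, hD⟩ := ht
    exact h1 (Set.mem_iUnion.2 ⟨(D, f ⟨t, ht⟩), htC, fun x' hx' => (hD x' hx').symm⟩)
  refine ⟨hS.toFinset ∪ d.1, C ∩ A d, d.2, by simp, Set.inter_subset_left, ?_, hd,
    fun t ht => ht.2 t fun _ _ => rfl⟩
  intro t t' h ht
  refine ⟨hC (fun i hi => h i (by simp [hi])) ht.1, fun x' hx' => ht.2 x' fun γ hγ => ?_⟩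
  rw [← hx' γ hγ]
  exact h γ (by simp [hγ])

open scoped Pointwise in
/-- A finite family of pairwise compatible tiles can be extended by a tile that occurs in a given
open set. -/
theorem exists_tile [Countable Γ] [Infinite Γ] [Countable Λ] {f : freePart unitInterval Γ → Λ}
    (hf : ∀ᵐ t ∂productMeasure Γ, ∃ ht : t ∈ freePart unitInterval Γ, ∃ D : Finset Γ,
      ∀ x' : freePart unitInterval Γ, (∀ γ ∈ D, t γ = x'.val γ) → f ⟨t, ht⟩ = f x')
    (L : Finset (Tile f)) (hL : ∀ P ∈ L, ∀ Q ∈ L, P.Compatible Q)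
    {U : Set (ShiftSpace (Fin 2) Γ)} (hU : IsOpen U) (hne : U.Nonempty) :
    ∃ Q : Tile f, (∀ P ∈ L, P.Compatible Q) ∧ Q.Compatible Q ∧
      ∃ x ∈ freePart (Fin 2) Γ, x ∈ U ∧ x ∈ Q.loc := by
  classical
  obtain ⟨x, hxU, hxf, hxfin, δ₀, hδ₀⟩ := exists_mem_freePart_finite_support hU hne
  let T : Set (Set Γ × Set (ShiftSpace unitInterval Γ)) :=
    ⋃ P ∈ L, P.place '' {γ : Γ | γ • x ∈ P.loc}
  have hT : ∀ {p}, p ∈ T ↔ ∃ P ∈ L, ∃ γ : Γ, γ • x ∈ P.loc ∧ P.place γ = p := by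
    simp [T]
  have hTfin : T.Finite := L.finite_toSet.biUnion fun P _ => (P.finite_occurrences hxfin).image _
  have hTs : ∀ p ∈ T, IsSupportedOn (ι := Γ) p.2 p.1 := fun p hp => by
    obtain ⟨P, -, γ, -, rfl⟩ := hT.1 hp
    exact P.isSupportedOn_place γ
  have hC0 : productMeasure Γ (⋂ p ∈ T, p.2) ≠ 0 := by
    have hTeq : ⋂ p ∈ T, p.2 = ⋂ p ∈ hTfin.toFinset, p.2 := by
      simp only [hTfin.mem_toFinset]
    rw [hTeq]
    exact infinitePi_biInter_ne_zero (volume : Measure unitInterval) hTfin.toFinset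
      (fun p hp => hTs p (hTfin.mem_toFinset.1 hp))
      (fun p hp => by
        obtain ⟨P, -, γ, -, rfl⟩ := hT.1 (hTfin.mem_toFinset.1 hp)
        exact P.place_ne_zero γ)
      (fun p hp q hq => by
        obtain ⟨P, hP, γ, hγ, rfl⟩ := hT.1 (hTfin.mem_toFinset.1 hp)
        obtain ⟨Q, hQ, η, hη, rfl⟩ := hT.1 (hTfin.mem_toFinset.1 hq)
        exact hL P hP Q hQ x γ η hγ hη)
  have hSfin : (⋃ p ∈ T, p.1).Finite := hTfin.biUnion fun p hp => by
    obtain ⟨P, -, γ, -, rfl⟩ := hT.1 hp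
    exact P.finite_place γ
  obtain ⟨D, B, l, hSD, hBC, hB, hB0, hBl⟩ :=
    exists_subset_const hf hSfin (IsSupportedOn.biInter hTs) hC0
  have hne : ∀ γ : Γ, ∃ δ, γ ≠ 1 → x (δ * γ) ≠ x δ := fun γ => by
    by_cases hγ : γ = 1
    · exact ⟨1, fun h => absurd hγ h⟩
    · obtain ⟨δ, hδ⟩ := ShiftSpace.ne_iff.1 (hxf γ hγ)
      exact ⟨δ, fun _ => hδ⟩
  choose ε hε using hne
  have hclopen : ∀ δ, IsClopen {y : ShiftSpace (Fin 2) Γ | y δ = x δ} := fun δ =>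
    (isClopen_discrete {x δ}).preimage (ShiftSpace.continuous_eval δ)
  -- `V₁` retains a nonzero coordinate. On `V₂`, the earlier tiles whose translated coordinates meet
  -- `D` occur exactly as in `x`, so the new condition `B` refines theirs. `V₃` records that each `γ
  -- ≠ 1` in `D⁻¹ * D` moves `x`, so distinct occurrences of the new tile are disjoint.
  let V₁ : Set (ShiftSpace (Fin 2) Γ) := {y | y δ₀ = x δ₀}
  let V₂ : Set (ShiftSpace (Fin 2) Γ) :=
    ⋂ P ∈ L, ⋂ γ ∈ P.supp⁻¹ * D, {y | γ • y ∈ P.loc ↔ γ • x ∈ P.loc}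
  let V₃ : Set (ShiftSpace (Fin 2) Γ) :=
    ⋂ γ ∈ D⁻¹ * D, {y | y (ε γ * γ) = x (ε γ * γ)} ∩ {y | y (ε γ) = x (ε γ)}
  have hV₂ : IsClopen V₂ := by
    refine isClopen_biInter_finset fun P _ => isClopen_biInter_finset fun γ _ => ?_
    have h1 : IsClopen {y : ShiftSpace (Fin 2) Γ | γ • y ∈ P.loc} :=
      P.isClopen_loc.preimage (ShiftSpace.continuous_smul γ)
    by_cases h : γ • x ∈ P.loc
    · simpa only [h, iff_true] using h1
    · simp only [h, iff_false]
      exact h1.compl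
  have hV₃ : IsClopen V₃ :=
    isClopen_biInter_finset fun γ _ => (hclopen (ε γ * γ)).inter (hclopen (ε γ))
  let Q : Tile f :=
    { supp := D
      cond := B
      loc := V₁ ∩ V₂ ∩ V₃
      value := l
      isSupportedOn := hB
      cond_ne_zero := hB0
      eq_value := hBl
      isClopen_loc := ((hclopen δ₀).inter hV₂).inter hV₃
      exists_ne_zero := ⟨{δ₀}, fun y hy => ⟨δ₀, by simp, by rw [hy.1.1]; exact hδ₀⟩⟩ }
  have hQ1 : Q.place 1 = (↑D, B) := by
    ext <;> simp [Tile.place, Q]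
  refine ⟨Q, fun P hP => ?_, ?_, x, hxf, hxU, ⟨rfl, ?_⟩, ?_⟩
  · refine Tile.compatible_of_forall_one fun y hy γ hγ => ?_
    rw [hQ1]
    by_cases hd : Disjoint (P.place γ).1 D
    · exact .inl hd
    obtain ⟨δ, hδP, hδD⟩ := Set.not_disjoint_iff.1 hd
    have hγmem : γ ∈ P.supp⁻¹ * D := by
      have : γ = (δ * γ⁻¹)⁻¹ * δ := by group
      rw [this]
      exact Finset.mul_mem_mul (Finset.inv_mem_inv hδP) hδD
    have hγx : γ • x ∈ P.loc := (Set.mem_iInter₂.1 (Set.mem_iInter₂.1 hy.1.2 P hP) γ hγmem).1 hγ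
    have hpT : P.place γ ∈ T := hT.2 ⟨P, hP, γ, hγx, rfl⟩
    exact .inr (.inl ⟨(Set.subset_biUnion_of_mem (u := Prod.fst) hpT).trans hSD,
      hBC.trans (Set.biInter_subset_of_mem hpT)⟩)
  · refine Tile.compatible_of_forall_one fun y hy γ hγ => ?_
    by_cases h1 : γ = 1
    · exact h1 ▸ Laminar.refl _
    refine .inl (Set.disjoint_left.2 fun δ hδ hδD => ?_)
    rw [hQ1] at hδD
    have hγmem : γ ∈ D⁻¹ * D := by
      have : γ = (δ * γ⁻¹)⁻¹ * δ := by group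
      rw [this]
      exact Finset.mul_mem_mul (Finset.inv_mem_inv hδ) hδD
    have h2 := (Set.mem_iInter₂.1 hy.2 γ hγmem).1
    have h3 := (Set.mem_iInter₂.1 hγ.2 γ hγmem).2
    exact hε γ h1 (h2.symm.trans h3)
  · exact Set.mem_iInter₂.2 fun P _ => Set.mem_iInter₂.2 fun γ _ => Iff.rfl
  · exact Set.mem_iInter₂.2 fun γ _ => ⟨rfl, rfl⟩

end Tile

/-! ### Dense families of tiles and the generic labelling -/

/-- A finitely generated group is countable. -/
theorem Group.FG.countable (Γ : Type u) [Group Γ] [Group.FG Γ] : Countable Γ := by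
  obtain ⟨S, hS, φ, hφ⟩ := Group.fg_iff_exists_freeGroup_hom_surjective_finite.1 ‹Group.FG Γ›
  exact hφ.countable

instance (Γ : Type u) [Countable Γ] : SecondCountableTopology (ShiftSpace (Fin 2) Γ) :=
  inferInstanceAs (SecondCountableTopology (Γ → Fin 2))

instance (X : Type w) [TopologicalSpace X] [T2Space X] (Γ : Type u) : T2Space (ShiftSpace X Γ) :=
  inferInstanceAs (T2Space (Γ → X))

section Tile

variable {Γ : Type u} [Group Γ]

/-- There is a countable family of pairwise compatible tiles whose union is dense in the free
part. -/
theorem exists_tile_seq [Countable Γ] [Infinite Γ] {Λ : Type v} [Countable Λ]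
    {f : freePart unitInterval Γ → Λ}
    (hf : ∀ᵐ t ∂productMeasure Γ, ∃ ht : t ∈ freePart unitInterval Γ, ∃ D : Finset Γ,
      ∀ x' : freePart unitInterval Γ, (∀ γ ∈ D, t γ = x'.val γ) → f ⟨t, ht⟩ = f x') :
    ∃ g : ℕ → Tile f, (∀ m n, (g m).Compatible (g n)) ∧
      ∀ U : Set (ShiftSpace (Fin 2) Γ), IsOpen U → U.Nonempty →
        ∃ n, ∃ x ∈ freePart (Fin 2) Γ, x ∈ U ∧ x ∈ (g n).loc := by
  let 𝓑 := TopologicalSpace.countableBasis (ShiftSpace (Fin 2) Γ)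
  have h𝓑 : TopologicalSpace.IsTopologicalBasis 𝓑 := TopologicalSpace.isBasis_countableBasis _
  obtain ⟨b₀, hb₀, -⟩ := h𝓑.exists_subset_of_mem_open
    (Set.mem_univ ((fun _ => 0 : Γ → Fin 2) : ShiftSpace (Fin 2) Γ)) isOpen_univ
  obtain ⟨e, he⟩ := (TopologicalSpace.countable_countableBasis
    (ShiftSpace (Fin 2) Γ)).exists_eq_range ⟨b₀, hb₀⟩
  have hmem : ∀ n, e n ∈ 𝓑 := fun n => (Set.ext_iff.1 he _).2 (Set.mem_range_self n)
  obtain ⟨g, hg, hge⟩ := exists_seq_pairwise (α := Tile f) Tile.Compatible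
    (fun _ _ h => h.symm) (fun n Q => ∃ x ∈ freePart (Fin 2) Γ, x ∈ e n ∧ x ∈ Q.loc)
    fun n L hL => exists_tile hf L hL (TopologicalSpace.isOpen_of_mem_countableBasis (hmem n))
      (TopologicalSpace.nonempty_of_mem_countableBasis (hmem n))
  refine ⟨g, hg, fun U hU ⟨y, hy⟩ => ?_⟩
  obtain ⟨b, hb, -, hbU⟩ := h𝓑.exists_subset_of_mem_open hy hU
  obtain ⟨n, rfl⟩ : b ∈ Set.range e := (Set.ext_iff.1 he b).1 hb
  obtain ⟨x, hxf, hxe, hx⟩ := hge n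
  exact ⟨n, x, hxf, hbU hxe, hx⟩

/-- If pairwise compatible tiles `g (n w)` occur at the points `w • x`, then some point of the free
part of `[0, 1] ^ Γ` satisfies all their constraints. -/
theorem exists_freePart_forall_eq_value [Countable Γ] {Λ : Type v}
    {f : freePart unitInterval Γ → Λ} {g : ℕ → Tile f} (hg : ∀ m n, (g m).Compatible (g n))
    (x : ShiftSpace (Fin 2) Γ) (W : Finset Γ) (n : Γ → ℕ)
    (hn : ∀ w ∈ W, w • x ∈ (g (n w)).loc) :
    ∃ t : freePart unitInterval Γ, ∀ w ∈ W, f (w • t) = (g (n w)).value := by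
  classical
  have h0 := infinitePi_biInter_ne_zero (volume : Measure unitInterval)
    (W.image fun w => (g (n w)).place w)
    (fun p hp => by
      obtain ⟨w, -, rfl⟩ := Finset.mem_image.1 hp
      exact (g (n w)).isSupportedOn_place w)
    (fun p hp => by
      obtain ⟨w, -, rfl⟩ := Finset.mem_image.1 hp
      exact (g (n w)).place_ne_zero w)
    (fun p hp q hq => by
      obtain ⟨w, hw, rfl⟩ := Finset.mem_image.1 hp
      obtain ⟨z, hz, rfl⟩ := Finset.mem_image.1 hq
      exact hg _ _ x w z (hn w hw) (hn z hz))
  -- A set of positive outer measure meets the conull free part.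
  have hfreq := frequently_ae_mem_iff.2 h0
  obtain ⟨t, ht, htf⟩ := (hfreq.and_eventually (ae_mem_freePart (Γ := Γ))).exists
  refine ⟨⟨t, htf⟩, fun w hw => (g (n w)).eq_value _ ?_⟩
  exact Set.mem_iInter₂.1 ht _ (Finset.mem_image_of_mem _ hw)

/-- For a dense family of tiles, a generic point of the free part has a tile at each point of its
orbit. -/
theorem eventually_residual_forall_exists_mem_loc [Countable Γ] {Λ : Type v}
    {f : freePart unitInterval Γ → Λ} {g : ℕ → Tile f}
    (hd : ∀ U : Set (ShiftSpace (Fin 2) Γ), IsOpen U → U.Nonempty →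
        ∃ n, ∃ x ∈ freePart (Fin 2) Γ, x ∈ U ∧ x ∈ (g n).loc) :
    ∀ᶠ x : freePart (Fin 2) Γ in residual _, ∀ γ : Γ, ∃ n, γ • x.val ∈ (g n).loc := by
  refine eventually_countable_forall.2 fun γ => ?_
  refine residual_of_dense_open (s := {x : freePart (Fin 2) Γ | ∃ n, γ • x.val ∈ (g n).loc}) ?_ ?_
  · have : {x : freePart (Fin 2) Γ | ∃ n, γ • x.val ∈ (g n).loc} =
        ⋃ n, (fun x : freePart (Fin 2) Γ => γ • x.val) ⁻¹' (g n).loc := by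
      ext; simp
    rw [this]
    exact isOpen_iUnion fun n => (g n).isClopen_loc.isOpen.preimage
      ((ShiftSpace.continuous_smul γ).comp continuous_subtype_val)
  · rw [dense_iff_inter_open]
    rintro _ ⟨U, hU, rfl⟩ ⟨x, hx⟩
    obtain ⟨n, y, hyf, hyU, hy⟩ := hd ((fun y => γ⁻¹ • y) ⁻¹' U)
      (hU.preimage (ShiftSpace.continuous_smul γ⁻¹)) ⟨γ • x.val, by simpa using hx⟩
    refine ⟨γ⁻¹ • ⟨y, hyf⟩, hyU, n, ?_⟩
    simpa using hy

open Classical in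
/-- The labelling by the first tile that occurs is Baire measurable. -/
theorem baireMeasurableSet_of_eq_value {X : Type w} [TopologicalSpace X] {Λ : Type v}
    {V : ℕ → Set X} (hV : ∀ n, IsClopen (V n)) (l : ℕ → Λ) {F : X → Λ}
    (hF : ∀ᶠ x in residual X, ∃ h : ∃ n, x ∈ V n, F x = l (Nat.find h)) :
    IsBaireMeasurable F := by
  intro s
  -- Here the first tile that occurs has its label in `s`; clopenness makes this an open condition.
  have hopen : IsOpen (⋃ n ∈ {n | l n ∈ s}, V n \ ⋃ m ∈ Finset.range n, V m) :=
    isOpen_biUnion fun n _ => ((hV n).diff (isClopen_biUnion_finset fun m _ => hV m)).isOpen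
  refine hopen.baireMeasurableSet.congr ?_
  rw [Filter.eventuallyEq_set]
  filter_upwards [hF] with x hx
  obtain ⟨h, hx⟩ := hx
  simp only [Set.mem_iUnion, Set.mem_sdiff, Finset.mem_range, Set.mem_preimage, hx, exists_prop,
    not_exists, not_and]
  constructor
  · rintro ⟨n, hns, hn, hm⟩
    rw [(Nat.find_eq_iff h).2 ⟨hn, hm⟩]
    exact hns
  · exact fun hs => ⟨Nat.find h, hs, Nat.find_spec h, fun m hm => Nat.find_min h hm⟩

end Tile

theorem theorem1p9 (Γ : Type u) [Group Γ] [Group.FG Γ] :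
    FFIID.{u, v} Γ ⊆ BaireSHIFT.{u, v} Γ := by
  classical
  rintro P ⟨f, hf, -, hfin⟩
  have := Group.FG.countable Γ
  have := P.finite_label
  obtain ⟨t₀, ht₀⟩ := (ae_mem_freePart (Γ := Γ)).exists
  obtain ⟨s, hs⟩ := hf.exists_freePart ⟨t₀, ht₀⟩ (Fin 2)
  cases finite_or_infinite Γ with
  | inl _ =>
    have : Finite (freePart (Fin 2) Γ) :=
      Finite.of_injective (β := Γ → Fin 2) Subtype.val Subtype.val_injective
    exact ⟨s, hs, fun A => (isOpen_discrete (s ⁻¹' A)).baireMeasurableSet⟩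
  | inr _ =>
    obtain ⟨g, hg, hd⟩ := exists_tile_seq (ae_of_ae_iidMeasure hfin)
    -- `S` is invariant, so each orbit is labelled entirely by tiles or entirely by `s`.
    let S : Set (freePart (Fin 2) Γ) := {x | ∀ γ : Γ, ∃ n, γ • x.val ∈ (g n).loc}
    have hS1 : ∀ {x}, x ∈ S → ∃ n, x.val ∈ (g n).loc := fun {x} hx => by simpa using hx 1
    have hSsmul : ∀ (γ : Γ) x, γ • x ∈ S ↔ x ∈ S := by
      intro γ x
      constructor
      · intro h η
        simpa [smul_smul] using h (η * γ⁻¹)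
      · intro h η
        simpa [smul_smul] using h (η * γ)
    let F : freePart (Fin 2) Γ → P.Label := fun x =>
      if h : x ∈ S then (g (Nat.find (hS1 h))).value else s x
    refine ⟨F, fun x => ?_, ?_⟩
    · by_cases hx : x ∈ S
      · have hx' : ∀ w : Γ, w • x ∈ S := fun w => (hSsmul w x).2 hx
        obtain ⟨t, ht⟩ := exists_freePart_forall_eq_value hg x.val P.window
          (fun w => Nat.find (hS1 (hx' w))) fun w _ => Nat.find_spec (hS1 (hx' w))
        convert hf t using 2 with w
        simp only [F, hx', dite_true]
        exact (ht w w.2).symm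
      · convert hs x using 2 with w
        simp only [F, hSsmul, hx, dite_false]
    · refine baireMeasurableSet_of_eq_value (V := fun n => Subtype.val ⁻¹' (g n).loc)
        (fun n => (g n).isClopen_loc.preimage continuous_subtype_val) (fun n => (g n).value) ?_
      filter_upwards [eventually_residual_forall_exists_mem_loc hd] with x hx
      exact ⟨hS1 hx, dif_pos hx⟩
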